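/- A function $\Phi$ is admissible if for some $\Delta>0$ it is defined and monotonic on $(0,\Delta)$, satisfies $0<\Phi(\delta)\le\delta$ for all $\delta\in(0,\Delta)$, and $\Phi(\delta)/\delta\to 0$ as $\delta\to 0^+$. A metric space $X$ is uniformly perfect if there is $c\in(0,1)$ such that $B(x,R)\setminus B(x,cR)\ne\varnothing$ for all $x\in X$ and $0<R<|X|$, where $B(x,R)$ is the open ball and $|\cdot|$ denotes diameter. For a subset $F$ of a metric space $X$ and admissible $\Phi$, the upper $\Phi$-intermediate dimension $\overline{\dim}^\Phi F$ is the infimum of all $s\ge 0$ such that for every $\epsilon>0$ there is $\delta_0\in(0,1]$ such that for all $\delta\in(0,\delta_0)$ there is a countable cover $\{U_i\}$ of $F$ by subsets of $X$ with $\Phi(\delta)\le|U_i|\le\delta$ for all $i$ and $\sum_i|U_i|^s\le\epsilon$. The lower $\Phi$-intermediate dimension $\underline{\dim}^\Phi F$ is the infimum of all $s\ge0$ such that for every $\epsilon>0$ and every $\delta_0\in(0,1]$ there are $\delta\in(0,\delta_0)$ and a cover with the same properties. Let $N_\delta(F)$ be the least number of open balls of radius $\delta/2$ centred in $F$ that cover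 $F$. Write $\overline{\dim}_{\mathrm B}F=\limsup_{\delta\to0^+}\frac{\log N_\delta(F)}{-\log\delta}$, and let $\dim_{\mathrm A}F$ be the infimum of all $\alpha\ge 0$ for which there is $C>0$ with $N_r(B(x,R)\cap F)\le C(R/r)^\alpha$ for all $x\in F$ and $0<r<R$. **Theorem.** Let $\Phi$ be admissible, let $(X,d_X)$ and $(Y,d_Y)$ be uniformly perfect metric spaces, each with more than one point, and let $E\subseteq X$ and $F\subseteq Y$ be non-empty and totally bounded with $\dim_{\mathrm A}E<\infty$ and $\dim_{\mathrm A}F<\infty$. Let $d_{X\times Y}$ be a metric on $X\times Y$ such that $c_1\max(d_X,d_Y)\le d_{X\times Y}\le c_2\max(d_X,d_Y)$ for some constants $c_1,c_2\in(0,\infty)$. Then, with dimensions of $E\times F$ computed in $(X\times Y,d_{X\times Y})$: (i) $\overline{\dim}^\Phi E+\underline{\dim}^\Phi F\le\overline{\dim}^\Phi(E\times F)\le\overline{\dim}^\Phi E+\overline{\dim}_{\mathrm B}F$; (ii) $\underline{\dim}^\Phi E+\underline{\dim}^\Phi F\le\underline{\dim}^\Phi(E\times F)\le\underline{\dim}^\Phi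 E+\overline{\dim}_{\mathrm B}F$. (iii) For self-products, if $d_{Y\times Y}$ is a metric on $Y\times Y$ that is comparable to the maximum metric in the same sense, then $2\,\overline{\dim}^\Phi F\le\overline{\dim}^\Phi(F\times F)\le\overline{\dim}^\Phi F+\overline{\dim}_{\mathrm B}F$. -/

import Mathlib

open Set Filter Topology
open scoped NNReal ENNReal

noncomputable section

namespace PhiDim

/-- A gauge `Φ` is admissible if, on some interval `(0, Δ)`, it is monotonic, satisfies
`0 < Φ δ ≤ δ`, and `Φ δ / δ → 0` as `δ → 0⁺`.  Only the values on `(0, Δ)` matter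
(a gauge squeezed between `0` and `δ` that is monotonic is necessarily non-decreasing near `0`). -/
def Admissible (Φ : ℝ → ℝ) : Prop :=
  ∃ Δ : ℝ, 0 < Δ ∧
    (MonotoneOn Φ (Ioo 0 Δ) ∨ AntitoneOn Φ (Ioo 0 Δ)) ∧
    (∀ δ ∈ Ioo 0 Δ, 0 < Φ δ ∧ Φ δ ≤ δ) ∧
    Tendsto (fun δ => Φ δ / δ) (𝓝[>] 0) (𝓝 0)

/-- `X` is uniformly perfect: for some `c ∈ (0,1)`, all the annuli `B(x,R) \ B(x,cR)` with
`0 < R < |X|` are non-empty (the diameter `|X|` may be infinite). -/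
def UniformlyPerfect (X : Type*) [MetricSpace X] : Prop :=
  ∃ c ∈ Ioo (0 : ℝ) 1, ∀ (x : X) (R : ℝ), 0 < R → ENNReal.ofReal R < Metric.ediam (univ : Set X) →
    (Metric.ball x R \ Metric.ball x (c * R)).Nonempty

/-- `N_δ(F)`: the least number of open balls of radius `δ / 2`, centred in `F`, that cover `F`
(`⊤` if no finite number suffices). -/
def coverNum {X : Type*} [MetricSpace X] (δ : ℝ) (F : Set X) : ℕ∞ :=
  ⨅ (t : Finset X) (_ : (t : Set X) ⊆ F ∧ F ⊆ ⋃ x ∈ t, Metric.ball x (δ / 2)), (t.card : ℕ∞)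

/-- The upper box dimension `limsup_{δ → 0⁺} log N_δ(F) / (- log δ)`. -/
def upperBoxDim {X : Type*} [MetricSpace X] (F : Set X) : ℝ≥0∞ :=
  limsup (fun δ : ℝ => (ENNReal.log (coverNum δ F : ℝ≥0∞)).toENNReal
    / ENNReal.ofReal (-Real.log δ)) (𝓝[>] 0)

/-- The Assouad dimension: the infimum of the `α` for which there is `C > 0` such that
`N_r(B(x,R) ∩ F) ≤ C (R/r)^α` for all `x ∈ F` and `0 < r < R`. -/
def assouadDim {X : Type*} [MetricSpace X] (F : Set X) : ℝ≥0∞ :=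
  ⨅ (α : ℝ≥0) (_ : ∃ C : ℝ, 0 < C ∧ ∀ x ∈ F, ∀ r R : ℝ, 0 < r → r < R →
    (coverNum r (Metric.ball x R ∩ F) : ℝ≥0∞) ≤ ENNReal.ofReal (C * (R / r) ^ (α : ℝ))),
    (α : ℝ≥0∞)

/-- `F` has a countable cover by subsets `U` of the ambient space with
`Φ δ ≤ |U| ≤ δ` for every `U` in the cover and `∑ |U| ^ s ≤ ε`. -/
def HasCover {X : Type*} [MetricSpace X] (Φ : ℝ → ℝ) (F : Set X) (s : ℝ≥0) (ε δ : ℝ) : Prop :=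
  ∃ 𝒰 : Set (Set X), 𝒰.Countable ∧ F ⊆ ⋃₀ 𝒰 ∧
    (∀ U ∈ 𝒰, ENNReal.ofReal (Φ δ) ≤ Metric.ediam U ∧ Metric.ediam U ≤ ENNReal.ofReal δ) ∧
    ∑' U : 𝒰, Metric.ediam (U : Set X) ^ (s : ℝ) ≤ ENNReal.ofReal ε

/-- The upper `Φ`-intermediate dimension. -/
def upperPhiDim {X : Type*} [MetricSpace X] (Φ : ℝ → ℝ) (F : Set X) : ℝ≥0∞ :=
  ⨅ (s : ℝ≥0) (_ : ∀ ε : ℝ, 0 < ε → ∃ δ₀ ∈ Ioc (0 : ℝ) 1, ∀ δ ∈ Ioo 0 δ₀, HasCover Φ F s ε δ),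
    (s : ℝ≥0∞)

/-- The lower `Φ`-intermediate dimension. -/
def lowerPhiDim {X : Type*} [MetricSpace X] (Φ : ℝ → ℝ) (F : Set X) : ℝ≥0∞ :=
  ⨅ (s : ℝ≥0) (_ : ∀ ε : ℝ, 0 < ε → ∀ δ₀ ∈ Ioc (0 : ℝ) 1, ∃ δ ∈ Ioo 0 δ₀, HasCover Φ F s ε δ),
    (s : ℝ≥0∞)

/-- The metric `m` on `X × Y` satisfies `c₁ max(d_X, d_Y) ≤ m ≤ c₂ max(d_X, d_Y)` for some
`c₁, c₂ ∈ (0, ∞)`. -/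
def ComparableToMax {X Y : Type*} [MetricSpace X] [MetricSpace Y]
    (m : MetricSpace (X × Y)) : Prop :=
  ∃ c₁ c₂ : ℝ, 0 < c₁ ∧ 0 < c₂ ∧ ∀ p q : X × Y,
    c₁ * max (dist p.1 q.1) (dist p.2 q.2) ≤ m.dist p q ∧
    m.dist p q ≤ c₂ * max (dist p.1 q.1) (dist p.2 q.2)

end PhiDim

end

open Set Filter Topology
open scoped NNReal ENNReal

namespace PhiDim


/-! Both bounds are proved one scale `δ` at a time, and the dimensions enter only at the end.
Constraints on diameters may be relaxed by constant factors. Uniform perfectness makes a ball of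
radius `ρ` have diameter at least `c * ρ`, so sets that are too small can be enlarged. Finite
Assouad dimension gives doubling, so sets that are too large can be cut into boundedly many balls
(`exists_adjusted_cover`, `hasCover_of_finset`).

Upper bounds: over each `U` in a cover of `E`, place about `|U| ^ (-t)` balls of radius `|U| / 2`
covering `F`. The factor cancels the extra exponent `t` (`HasCover.prod`).

Lower bounds: a cheap cover of `E × F` with exponent `s + t` yields a cheap cover of `E` for `s` or
of `F` for `t`, at the same scale (`hasCover_or_hasCover_of_prod`). Give the projection of each `W`
to `X` the weight `|W| ^ t`. If `F` has no cheap cover, the fibres over each `x ∈ E` have total cost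
bounded below, so the projections form a weighted cover of `E`. A Vitali argument replaces it by an
unweighted cover of comparable cost (`exists_subcover_of_weighted`), with no Frostman measure
needed. It remains to find a scale where both factors fail: one may fail only at arbitrarily small
scales if the other fails at all small ones, and in a self-product the two failures coincide. -/

/-- Small balls of radius `ρ` contain a point at distance at least `c * ρ` from the centre. -/
def BallSpread (X : Type*) [MetricSpace X] (c ρ₀ : ℝ) : Prop :=
  ∀ (x : X) (ρ : ℝ), 0 < ρ → ρ < ρ₀ → ∃ y ∈ Metric.ball x ρ, c * ρ ≤ dist y x

/-- Balls in `E` are covered by boundedly many balls of proportional radius. -/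
def Doubling {X : Type*} [MetricSpace X] (E : Set X) : Prop :=
  ∀ K : ℝ, ∃ N : ℕ, ∀ x ∈ E, ∀ ρ : ℝ, 0 < ρ → ∃ t : Finset X, t.card ≤ N ∧
    Metric.ball x (K * ρ) ∩ E ⊆ ⋃ y ∈ t, Metric.ball y ρ

theorem UniformlyPerfect.exists_ballSpread {X : Type*} [MetricSpace X] [Nontrivial X]
    (h : UniformlyPerfect X) : ∃ c ρ₀ : ℝ, 0 < c ∧ 0 < ρ₀ ∧ BallSpread X c ρ₀ := by
  obtain ⟨c, ⟨hc0, -⟩, hc⟩ := h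
  obtain ⟨x, y, hxy⟩ := exists_pair_ne X
  refine ⟨c, dist x y, hc0, dist_pos.2 hxy, fun z ρ hρ hρ' => ?_⟩
  obtain ⟨w, hw, hw'⟩ := hc z ρ hρ (by
    refine lt_of_lt_of_le ?_ (Metric.edist_le_ediam_of_mem (mem_univ x) (mem_univ y))
    rw [edist_dist]
    exact (ENNReal.ofReal_lt_ofReal_iff (dist_pos.2 hxy)).2 hρ')
  exact ⟨w, hw, by simpa using hw'⟩

theorem exists_finset_of_coverNum_le {X : Type*} [MetricSpace X] {δ a : ℝ} {F : Set X}
    (h : (coverNum δ F : ℝ≥0∞) ≤ ENNReal.ofReal a) (ha : 0 ≤ a) :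
    ∃ t : Finset X, (t.card : ℝ) ≤ a ∧ F ⊆ ⋃ x ∈ t, Metric.ball x (δ / 2) := by
  by_contra! hcon
  have h1 : ((⌊a⌋₊ + 1 : ℕ) : ℕ∞) ≤ coverNum δ F := by
    refine le_iInf₂ fun t ht => ?_
    have h2 : a < t.card := by
      by_contra! h3
      exact hcon t h3 ht.2
    exact_mod_cast Nat.succ_le_of_lt ((Nat.floor_lt ha).2 h2)
  have h2 : ((⌊a⌋₊ + 1 : ℕ) : ℝ≥0∞) ≤ ENNReal.ofReal a := by
    refine le_trans ?_ h
    exact_mod_cast h1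
  rw [← ENNReal.ofReal_natCast, ENNReal.ofReal_le_ofReal_iff ha] at h2
  have := Nat.lt_floor_add_one a
  push_cast at h2
  linarith

theorem doubling_of_assouadDim_lt_top {X : Type*} [MetricSpace X] {E : Set X}
    (h : assouadDim E < ⊤) : Doubling E := by
  obtain ⟨α, hα⟩ := iInf_lt_iff.1 h
  obtain ⟨⟨C, hC, hcov⟩, -⟩ := iInf_lt_iff.1 hα
  intro K
  -- `coverNum` at `r` uses balls of radius `r / 2`, hence `r = 2 * ρ`. Taking `max K 3` ensures `r
  -- < R`.
  refine ⟨⌊C * (max K 3 / 2) ^ (α : ℝ)⌋₊, fun x hx ρ hρ => ?_⟩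
  have h3 : (3 : ℝ) ≤ max K 3 := le_max_right _ _
  have h1 := hcov x hx (2 * ρ) (max K 3 * ρ) (by positivity) (by nlinarith)
  rw [show max K 3 * ρ / (2 * ρ) = max K 3 / 2 by field_simp] at h1
  obtain ⟨t, ht, hsub⟩ := exists_finset_of_coverNum_le h1 (by positivity)
  refine ⟨t, Nat.le_floor ht, ?_⟩
  rw [show 2 * ρ / 2 = ρ by ring] at hsub
  refine subset_trans (inter_subset_inter_left _ (Metric.ball_subset_ball ?_)) hsub
  gcongr
  exact le_max_left _ _

/-! ### Adjusting covers to the allowed range of diameters -/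

/-- A bounded piece of a doubling set is covered by boundedly many sets of admissible diameter. -/
theorem exists_adjusted_cover {X : Type*} [MetricSpace X] {c ρ₀ : ℝ} (hc : 0 < c)
    (hX : BallSpread X c ρ₀) {E : Set X} (hE : Doubling E) {K : ℝ} (hK : 1 ≤ K) :
    ∃ (N : ℕ) (C : ℝ), 0 < C ∧ ∀ φ δ r : ℝ, 0 < φ → 0 < δ → δ < ρ₀ → φ ≤ c * δ / 2 →
      0 < r → φ ≤ K * r → r ≤ K * δ → ∀ U : Set X, (∀ x ∈ U, ∀ y ∈ U, dist x y ≤ r) →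
      ∃ 𝒱 : Finset (Set X), 𝒱.card ≤ N ∧ U ∩ E ⊆ ⋃ V ∈ 𝒱, V ∧
        ∀ V ∈ 𝒱, ENNReal.ofReal φ ≤ Metric.ediam V ∧ Metric.ediam V ≤ ENNReal.ofReal δ ∧
          Metric.ediam V ≤ ENNReal.ofReal (C * r) := by
  classical
  obtain ⟨N, hN⟩ := hE (4 * K)
  refine ⟨N + 1, 4 + 2 * K / c, by positivity, fun φ δ r hφ hδ hδ' hφδ hr hφr hrδ U hU => ?_⟩
  have key : ∀ (y : X) (ρ : ℝ), 0 < ρ → φ ≤ c * ρ → ρ ≤ δ / 2 →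
      ρ ≤ (2 + K / c) * r →
      ENNReal.ofReal φ ≤ Metric.ediam (Metric.ball y ρ) ∧
      Metric.ediam (Metric.ball y ρ) ≤ ENNReal.ofReal δ ∧
      Metric.ediam (Metric.ball y ρ) ≤ ENNReal.ofReal ((4 + 2 * K / c) * r) := by
    intro y ρ hρ h1 h2 h3
    have hd : Metric.ediam (Metric.ball y ρ) ≤ ENNReal.ofReal (2 * ρ) := by
      refine Metric.ediam_le fun a ha b hb => ?_
      rw [edist_dist]
      refine ENNReal.ofReal_le_ofReal ?_
      have := dist_triangle_right a b y
      rw [Metric.mem_ball] at ha hb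
      linarith
    refine ⟨?_, hd.trans (ENNReal.ofReal_le_ofReal (by linarith)),
      hd.trans (ENNReal.ofReal_le_ofReal ?_)⟩
    · obtain ⟨z, hz, hz'⟩ := hX y ρ hρ (by linarith)
      refine le_trans ?_ (Metric.edist_le_ediam_of_mem hz (Metric.mem_ball_self hρ))
      rw [edist_dist]
      exact ENNReal.ofReal_le_ofReal (by linarith)
    · have : (4 + 2 * K / c) * r = 2 * ((2 + K / c) * r) := by ring
      linarith
  rcases (U ∩ E).eq_empty_or_nonempty with h0 | ⟨x, hxU, hxE⟩
  · exact ⟨∅, by simp, by simp [h0], by simp⟩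
  -- For small `r` one ball suffices: radius `2 * r` swallows `U`, and radius `φ / c` forces
  -- diameter at least `φ`. Otherwise `δ` is comparable to `r`, and doubling supplies balls of
  -- radius `δ / 2`.
  by_cases hcase : 2 * r ≤ δ / 2
  · have hρ : 0 < max (2 * r) (φ / c) := lt_max_of_lt_left (by positivity)
    refine ⟨{Metric.ball x (max (2 * r) (φ / c))}, by simp, ?_, ?_⟩
    · rintro y ⟨hy, -⟩
      simp only [Finset.mem_singleton, iUnion_iUnion_eq_left, Metric.mem_ball]
      exact lt_of_lt_of_le (lt_of_le_of_lt (hU y hy x hxU) (by linarith)) (le_max_left _ _)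
    · intro V hV
      rw [Finset.mem_singleton] at hV
      subst hV
      refine key x _ hρ ?_ (max_le hcase ?_) (max_le ?_ ?_)
      · calc φ = c * (φ / c) := by field_simp
          _ ≤ _ := by gcongr; exact le_max_right _ _
      · rw [div_le_iff₀ hc]; linarith
      · have : 0 ≤ K / c * r := by positivity
        linarith
      · calc φ / c ≤ K * r / c := by gcongr
          _ = K / c * r := by ring
          _ ≤ _ := by linarith
  · push Not at hcase
    obtain ⟨t, ht, hsub⟩ := hN x hxE (δ / 2) (by positivity)
    refine ⟨t.image fun y => Metric.ball y (δ / 2), Finset.card_image_le.trans (by omega), ?_, ?_⟩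
    · rintro y ⟨hy, hyE⟩
      have : y ∈ Metric.ball x (4 * K * (δ / 2)) ∩ E := by
        refine ⟨?_, hyE⟩
        rw [Metric.mem_ball]
        have := hU y hy x hxU
        have : 0 < K * δ := by positivity
        linarith
      simpa using hsub this
    · intro V hV
      obtain ⟨y, -, rfl⟩ := Finset.mem_image.1 hV
      refine key y _ (by positivity) (by linarith) le_rfl ?_
      have : 0 ≤ K / c * r := by positivity
      linarith

/-- Each piece is replaced by boundedly many sets of admissible diameter, so the cost grows by a
factor depending only on the space, `E`, `K` and `s`, not on the scale. -/
theorem hasCover_of_finset {X : Type*} [MetricSpace X] {c ρ₀ : ℝ} (hc : 0 < c)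
    (hX : BallSpread X c ρ₀) {E : Set X} (hE : Doubling E) {K : ℝ} (hK : 1 ≤ K) (s : ℝ≥0) :
    ∃ A : ℝ, 0 < A ∧ ∀ (Φ : ℝ → ℝ) (δ : ℝ), 0 < Φ δ → 0 < δ → δ < ρ₀ → Φ δ ≤ c * δ / 2 →
      ∀ {ι : Type*} (I : Finset ι) (W : ι → Set X) (r : ι → ℝ),
        (∀ i ∈ I, 0 < r i ∧ Φ δ ≤ K * r i ∧ r i ≤ K * δ ∧
          ∀ x ∈ W i, ∀ y ∈ W i, dist x y ≤ r i) →
        E ⊆ ⋃ i ∈ I, W i → HasCover Φ E s (A * ∑ i ∈ I, r i ^ (s : ℝ)) δ := by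
  classical
  obtain ⟨N, C, hC, hadj⟩ := exists_adjusted_cover hc hX hE hK
  refine ⟨(N + 1) * C ^ (s : ℝ), by positivity, fun Φ δ hΦ hδ hδ' hφδ ι I W r hW hcov => ?_⟩
  have hadj' : ∀ i ∈ I, _ := fun i hi => hadj (Φ δ) δ (r i) hΦ hδ hδ' hφδ (hW i hi).1
    (hW i hi).2.1 (hW i hi).2.2.1 (W i) (hW i hi).2.2.2
  choose! 𝒱 h𝒱 using hadj'
  refine ⟨⋃ i ∈ I, (𝒱 i : Set (Set X)), ?_, ?_, ?_, ?_⟩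
  · exact I.countable_toSet.biUnion fun i _ => (𝒱 i).countable_toSet
  · intro x hx
    obtain ⟨i, hi, hxi⟩ := mem_iUnion₂.1 (hcov hx)
    obtain ⟨V, hV, hxV⟩ := mem_iUnion₂.1 ((h𝒱 i hi).2.1 ⟨hxi, hx⟩)
    exact ⟨V, mem_iUnion₂.2 ⟨i, hi, hV⟩, hxV⟩
  · intro V hV
    obtain ⟨i, hi, hV⟩ := mem_iUnion₂.1 hV
    exact ⟨((h𝒱 i hi).2.2 V hV).1, ((h𝒱 i hi).2.2 V hV).2.1⟩
  · refine (ENNReal.tsum_biUnion_le (fun V : Set X => Metric.ediam V ^ (s : ℝ)) I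
      fun i => (𝒱 i : Set (Set X))).trans ?_
    rw [Finset.mul_sum, ENNReal.ofReal_sum_of_nonneg fun i hi => by
      have := (hW i hi).1
      positivity]
    refine Finset.sum_le_sum fun i hi => ?_
    have hr := (hW i hi).1
    rw [Finset.tsum_subtype' (𝒱 i) (fun V : Set X => Metric.ediam V ^ (s : ℝ))]
    calc ∑ V ∈ 𝒱 i, Metric.ediam V ^ (s : ℝ)
        ≤ ∑ V ∈ 𝒱 i, ENNReal.ofReal ((C * r i) ^ (s : ℝ)) := by
          refine Finset.sum_le_sum fun V hV => ?_
          rw [← ENNReal.ofReal_rpow_of_nonneg (by positivity) s.coe_nonneg]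
          exact ENNReal.rpow_le_rpow ((h𝒱 i hi).2.2 V hV).2.2 s.2
      _ = ENNReal.ofReal ((𝒱 i).card * (C * r i) ^ (s : ℝ)) := by
          rw [Finset.sum_const, nsmul_eq_mul, ENNReal.ofReal_mul (by positivity),
            ENNReal.ofReal_natCast]
      _ ≤ _ := by
          refine ENNReal.ofReal_le_ofReal ?_
          rw [Real.mul_rpow hC.le hr.le, ← mul_assoc]
          gcongr
          have : ((𝒱 i).card : ℝ) ≤ N := by exact_mod_cast (h𝒱 i hi).1
          linarith

/-- Every term of the sum is at least `Φ δ ^ s > 0` and the sum is finite, so the cover is finite.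
-/
theorem HasCover.exists_finset {X : Type*} [MetricSpace X] {Φ : ℝ → ℝ} {F : Set X} {s : ℝ≥0}
    {ε δ : ℝ} (h : HasCover Φ F s ε δ) (hΦ : 0 < Φ δ) (hδ : 0 ≤ δ) (hε : 0 ≤ ε) :
    ∃ 𝒰 : Finset (Set X), F ⊆ ⋃ U ∈ 𝒰, U ∧
      (∀ U ∈ 𝒰, Φ δ ≤ Metric.diam U ∧ Metric.diam U ≤ δ ∧
        ∀ x ∈ U, ∀ y ∈ U, dist x y ≤ Metric.diam U) ∧
      ∑ U ∈ 𝒰, Metric.diam U ^ (s : ℝ) ≤ ε := by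
  obtain ⟨𝒰, -, hcov, hdiam, hsum⟩ := h
  have hfin : 𝒰.Finite := by
    have h1 := ENNReal.finite_const_le_of_tsum_ne_top
      (ne_top_of_le_ne_top ENNReal.ofReal_ne_top hsum)
      (ε := ENNReal.ofReal (Φ δ) ^ (s : ℝ))
      (by rw [ENNReal.ofReal_rpow_of_pos hΦ]
          exact (ENNReal.ofReal_pos.2 (by positivity)).ne')
    have h2 : {U : 𝒰 | ENNReal.ofReal (Φ δ) ^ (s : ℝ) ≤ Metric.ediam (U : Set X) ^ (s : ℝ)}
        = univ := eq_univ_of_forall fun U => ENNReal.rpow_le_rpow (hdiam U U.2).1 s.2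
    rw [h2, finite_univ_iff] at h1
    exact toFinite 𝒰
  have htop : ∀ U ∈ 𝒰, Metric.ediam U ≠ ⊤ := fun U hU =>
    ne_top_of_le_ne_top ENNReal.ofReal_ne_top (hdiam U hU).2
  refine ⟨hfin.toFinset, ?_, ?_, ?_⟩
  · simpa [sUnion_eq_biUnion] using hcov
  · intro U hU
    rw [hfin.mem_toFinset] at hU
    refine ⟨(ENNReal.ofReal_le_iff_le_toReal (htop U hU)).1 (hdiam U hU).1,
      ENNReal.toReal_le_of_le_ofReal hδ (hdiam U hU).2, fun x hx y hy => ?_⟩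
    exact Metric.dist_le_diam_of_mem' (htop U hU) hx hy
  · rw [← ENNReal.ofReal_le_ofReal_iff hε]
    refine le_trans (le_of_eq ?_) hsum
    have h1 : ∑' U : 𝒰, Metric.ediam (U : Set X) ^ (s : ℝ)
        = ∑ U ∈ hfin.toFinset, Metric.ediam U ^ (s : ℝ) := by
      rw [← Finset.tsum_subtype' hfin.toFinset (fun U : Set X => Metric.ediam U ^ (s : ℝ)),
        hfin.coe_toFinset]
    rw [h1, ENNReal.ofReal_sum_of_nonneg fun U _ => Real.rpow_nonneg Metric.diam_nonneg _]
    refine Finset.sum_congr rfl fun U hU => ?_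
    rw [← ENNReal.ofReal_rpow_of_nonneg Metric.diam_nonneg s.coe_nonneg, Metric.diam,
      ENNReal.ofReal_toReal (htop U (hfin.mem_toFinset.1 hU))]

theorem HasCover.mono {X : Type*} [MetricSpace X] {Φ : ℝ → ℝ} {F : Set X} {s : ℝ≥0}
    {ε ε' δ : ℝ} (h : HasCover Φ F s ε δ) (hε : ε ≤ ε') : HasCover Φ F s ε' δ := by
  obtain ⟨𝒰, h1, h2, h3, h4⟩ := h
  exact ⟨𝒰, h1, h2, h3, h4.trans (ENNReal.ofReal_le_ofReal hε)⟩

/-- With exponent zero every set costs 1. This handles the endpoint `s = 0`, which need not lie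
strictly below the dimension. -/
theorem not_hasCover_zero {X : Type*} [MetricSpace X] {Φ : ℝ → ℝ} {F : Set X} (hF : F.Nonempty)
    {δ : ℝ} (hΦ : 0 < Φ δ) (hδ : 0 ≤ δ) : ¬ HasCover Φ F 0 (1 / 2) δ := by
  intro h
  obtain ⟨𝒰, hcov, -, hsum⟩ := h.exists_finset hΦ hδ (by norm_num)
  obtain ⟨x, hx⟩ := hF
  obtain ⟨U, hU, -⟩ := mem_iUnion₂.1 (hcov hx)
  have h1 : (1 : ℝ) ≤ 𝒰.card := by exact_mod_cast Finset.card_pos.2 ⟨U, hU⟩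
  simp at hsum
  norm_num at hsum
  linarith


/-! ### From weighted covers to covers -/

/-- A weighted cover contains an enlarged unweighted cover of comparable cost. -/
theorem exists_subcover_of_weighted {ι X : Type*} {B B' : ι → Set X} {E : Set X} {c : ι → ℝ}
    (I : Finset ι) (hc : ∀ i ∈ I, 0 ≤ c i)
    (hV : ∀ S ⊆ I, ∃ J ⊆ S, (J : Set ι).PairwiseDisjoint B ∧ ∀ i ∈ S, B i ⊆ ⋃ j ∈ J, B' j)
    (w : ι → ℝ) (hw : ∀ i ∈ I, 0 ≤ w i) {a : ℝ} (ha : 0 < a)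
    (h : ∀ x ∈ E, ∀ S ⊆ I, (∀ i ∈ I, x ∈ B i → i ∈ S) → a ≤ ∑ i ∈ S, w i) :
    ∃ J ⊆ I, E ⊆ ⋃ j ∈ J, B' j ∧ a * ∑ j ∈ J, c j ≤ ∑ i ∈ I, w i * c i := by
  classical
  induction I using Finset.strongInduction generalizing w a with
  | H I ih =>
  obtain ⟨J, hJI, hJd, hJc⟩ := hV I subset_rfl
  have hEJ : E ⊆ ⋃ j ∈ J, B' j := by
    intro x hx
    by_contra hcon
    -- A point outside all enlargements lies in no `B i`, so its total weight would be zero.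
    have := h x hx ∅ (by simp) fun i hi hxi => (hcon (hJc i hi hxi)).elim
    simp at this
    linarith
  by_cases hJa : ∀ j ∈ J, a ≤ w j
  · refine ⟨J, hJI, hEJ, ?_⟩
    rw [Finset.mul_sum]
    calc ∑ j ∈ J, a * c j ≤ ∑ j ∈ J, w j * c j :=
          Finset.sum_le_sum fun j hj => mul_le_mul_of_nonneg_right (hJa j hj) (hc j (hJI hj))
      _ ≤ _ := Finset.sum_le_sum_of_subset_of_nonneg hJI fun i hi _ => mul_nonneg (hw i hi) (hc i hi)
  push Not at hJa
  obtain ⟨j₁, hj₁, hj₁a⟩ := hJa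
  obtain ⟨j₀, hj₀, hmin⟩ := J.exists_min_image w ⟨j₁, hj₁⟩
  have hθa : w j₀ < a := (hmin j₁ hj₁).trans_lt hj₁a
  set θ := w j₀ with hθ
  have hθ0 : 0 ≤ θ := hw j₀ (hJI hj₀)
  -- Lower the weights on `J` by their minimum `θ`. Then `j₀` has weight zero and can be dropped,
  -- and the induction continues with threshold `a - θ`.
  set w' : ι → ℝ := fun i => w i - if i ∈ J then θ else 0 with hw'
  have hsub : I.erase j₀ ⊆ I := Finset.erase_subset _ _
  have hzero : w' j₀ = 0 := by simp [hw', hj₀, hθ]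
  have hcost : ∑ i ∈ I.erase j₀, w' i * c i = ∑ i ∈ I, w i * c i - θ * ∑ j ∈ J, c j := by
    rw [Finset.sum_erase _ (by simp [hzero])]
    simp only [hw', sub_mul, Finset.sum_sub_distrib, ite_mul, zero_mul]
    rw [← Finset.sum_filter, Finset.filter_mem_eq_inter, Finset.inter_eq_right.2 hJI,
      Finset.mul_sum]
  obtain ⟨J', hJ'I, hEJ', hJ'⟩ := ih (I.erase j₀) (Finset.erase_ssubset (hJI hj₀))
    (fun i hi => hc i (hsub hi)) (fun S hS => hV S (hS.trans hsub)) w'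
    (fun i hi => by
      simp only [hw']
      split_ifs with hiJ
      · linarith [hmin i hiJ]
      · linarith [hw i (hsub hi)])
    (a := a - θ) (by linarith)
    (fun x hx S hS hxS => by
      have hS' : insert j₀ S ⊆ I := Finset.insert_subset (hJI hj₀) (hS.trans hsub)
      have hj₀S : j₀ ∉ S := fun h => Finset.notMem_erase j₀ I (hS h)
      set T := (insert j₀ S).filter fun i => x ∈ B i with hT
      have hTI : T ⊆ I := (Finset.filter_subset _ _).trans hS'
      have h1 := h x hx T hTI fun i hi hxi => by
        rw [hT, Finset.mem_filter, Finset.mem_insert]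
        refine ⟨?_, hxi⟩
        by_cases hij : i = j₀
        · exact Or.inl hij
        · exact Or.inr (hxS i (Finset.mem_erase.2 ⟨hij, hi⟩) hxi)
      -- By disjointness `x` lies in at most one `B j` with `j ∈ J`, so its total weight drops by at
      -- most `θ`.
      have hcard : ((T.filter fun i => i ∈ J).card : ℝ) ≤ 1 := by
        have : (T.filter fun i => i ∈ J).card ≤ 1 := by
          refine Finset.card_le_one.2 fun i hi j hj => ?_
          simp only [hT, Finset.mem_filter] at hi hj
          by_contra hij
          exact disjoint_left.1 (hJd hi.2 hj.2 hij) hi.1.2 hj.1.2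
        exact_mod_cast this
      have h2 : a - θ ≤ ∑ i ∈ T, w' i := by
        simp only [hw', Finset.sum_sub_distrib]
        rw [← Finset.sum_filter, Finset.sum_const, nsmul_eq_mul]
        nlinarith
      refine h2.trans ?_
      calc ∑ i ∈ T, w' i ≤ ∑ i ∈ insert j₀ S, w' i := by
            refine Finset.sum_le_sum_of_subset_of_nonneg (Finset.filter_subset _ _)
              fun i hi _ => ?_
            have hiI := hS' hi
            simp only [hw']
            split_ifs with hiJ
            · linarith [hmin i hiJ]
            · linarith [hw i hiI]
        _ = ∑ i ∈ S, w' i := by rw [Finset.sum_insert hj₀S, hzero, zero_add])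
  rw [hcost] at hJ'
  -- Here `(a - θ) * c(J') + θ * c(J)` is at most the weighted cost, where `c` of a family is its
  -- total cost, so the cheaper of `J` and `J'` works.
  rcases le_total (∑ j ∈ J, c j) (∑ j ∈ J', c j) with hle | hle
  · exact ⟨J, hJI, hEJ, by nlinarith⟩
  · exact ⟨J', hJ'I.trans hsub, hEJ', by nlinarith⟩

/-- A finite Vitali covering lemma for arbitrary sets of bounded diameter. -/
theorem exists_disjoint_enlargement {ι X : Type*} [MetricSpace X] (B : ι → Set X) (r : ι → ℝ)
    (S : Finset ι) (hr : ∀ i ∈ S, 0 ≤ r i)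
    (hB : ∀ i ∈ S, ∀ x ∈ B i, ∀ y ∈ B i, dist x y ≤ r i) :
    ∃ J ⊆ S, (J : Set ι).PairwiseDisjoint B ∧
      ∀ i ∈ S, B i ⊆ ⋃ j ∈ J, {x | ∃ y ∈ B j, dist x y ≤ 2 * r j} := by
  classical
  set T : Set ι := {i | i ∈ S ∧ (B i).Nonempty} with hT
  obtain ⟨u, huT, hdis, hu⟩ := Vitali.exists_disjoint_subfamily_covering_enlargement B T r 2
    one_lt_two (fun i hi => hr i hi.1) (∑ i ∈ S, r i)
    (fun i hi => Finset.single_le_sum hr hi.1) fun i hi => hi.2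
  have hufin : u.Finite := S.finite_toSet.subset fun i hi => (huT hi).1
  refine ⟨hufin.toFinset, fun i hi => (huT (hufin.mem_toFinset.1 hi)).1,
    by rwa [hufin.coe_toFinset], fun i hi x hx => ?_⟩
  obtain ⟨j, hj, ⟨y, hyi, hyj⟩, hij⟩ := hu i ⟨hi, x, hx⟩
  exact mem_iUnion₂.2 ⟨j, hufin.mem_toFinset.2 hj, y, hyj, (hB i hi x hx y hyi).trans hij⟩


/-! ### Covers of products at a fixed scale -/

section Product

variable {X Y Z : Type*} [MetricSpace X] [MetricSpace Y] [MetricSpace Z] {e : Z ≃ X × Y}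
  {c₁ c₂ : ℝ} {E : Set X} {F : Set Y}

/-- Moving only the first coordinate already gives the spread, so one uniformly perfect factor
suffices. -/
theorem BallSpread.of_equiv_prod {c ρ₀ : ℝ} (h : BallSpread X c ρ₀) (hc₁ : 0 < c₁) (hc₂ : 0 < c₂)
    (he₁ : ∀ p q : Z, c₁ * max (dist (e p).1 (e q).1) (dist (e p).2 (e q).2) ≤ dist p q)
    (he₂ : ∀ p q : Z, dist p q ≤ c₂ * max (dist (e p).1 (e q).1) (dist (e p).2 (e q).2)) :
    BallSpread Z (c₁ * c / c₂) (c₂ * ρ₀) := by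
  intro z ρ hρ hρ'
  obtain ⟨x, hx, hx'⟩ := h (e z).1 (ρ / c₂) (by positivity) (by rw [div_lt_iff₀ hc₂]; linarith)
  have h1 := he₁ (e.symm (x, (e z).2)) z
  have h2 := he₂ (e.symm (x, (e z).2)) z
  simp only [Equiv.apply_symm_apply, dist_self, max_eq_left dist_nonneg] at h1 h2
  refine ⟨e.symm (x, (e z).2), ?_, ?_⟩
  · rw [Metric.mem_ball] at hx ⊢
    rw [lt_div_iff₀ hc₂] at hx
    linarith
  · refine le_trans ?_ h1
    calc c₁ * c / c₂ * ρ = c₁ * (c * (ρ / c₂)) := by ring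
      _ ≤ _ := by gcongr

theorem Doubling.preimage_prod (hE : Doubling E) (hF : Doubling F) (hc₁ : 0 < c₁) (hc₂ : 0 < c₂)
    (he₁ : ∀ p q : Z, c₁ * max (dist (e p).1 (e q).1) (dist (e p).2 (e q).2) ≤ dist p q)
    (he₂ : ∀ p q : Z, dist p q ≤ c₂ * max (dist (e p).1 (e q).1) (dist (e p).2 (e q).2)) :
    Doubling (e ⁻¹' (E ×ˢ F)) := by
  classical
  intro K
  obtain ⟨N, hN⟩ := hE (K * c₂ / c₁)
  obtain ⟨M, hM⟩ := hF (K * c₂ / c₁)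
  refine ⟨N * M, fun z hz ρ hρ => ?_⟩
  obtain ⟨t, htN, ht⟩ := hN (e z).1 hz.1 (ρ / c₂) (by positivity)
  obtain ⟨u, huM, hu⟩ := hM (e z).2 hz.2 (ρ / c₂) (by positivity)
  refine ⟨(t ×ˢ u).image e.symm, ?_, ?_⟩
  · refine Finset.card_image_le.trans ?_
    rw [Finset.card_product]
    exact Nat.mul_le_mul htN huM
  · rintro w ⟨hw, hwE, hwF⟩
    rw [Metric.mem_ball] at hw
    have h1 : max (dist (e w).1 (e z).1) (dist (e w).2 (e z).2) < K * c₂ / c₁ * (ρ / c₂) := by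
      rw [show K * c₂ / c₁ * (ρ / c₂) = K * ρ / c₁ by field_simp, lt_div_iff₀ hc₁]
      linarith [he₁ w z]
    rw [max_lt_iff] at h1
    obtain ⟨x, hxt, hx⟩ := mem_iUnion₂.1 (ht ⟨Metric.mem_ball.2 h1.1, hwE⟩)
    obtain ⟨y, hyu, hy⟩ := mem_iUnion₂.1 (hu ⟨Metric.mem_ball.2 h1.2, hwF⟩)
    refine mem_iUnion₂.2 ⟨e.symm (x, y),
      Finset.mem_image_of_mem _ (Finset.mk_mem_product hxt hyu), ?_⟩
    have h2 := he₂ w (e.symm (x, y))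
    simp only [Equiv.apply_symm_apply] at h2
    have h3 : max (dist (e w).1 x) (dist (e w).2 y) < ρ / c₂ := max_lt hx hy
    rw [lt_div_iff₀ hc₂] at h3
    rw [Metric.mem_ball]
    linarith

theorem hasCover_or_hasCover_of_prod {c ρ₀ : ℝ} (hc : 0 < c)
    (hX : BallSpread X c ρ₀) (hY : BallSpread Y c ρ₀) (hE : Doubling E) (hF : Doubling F)
    (hc₁ : 0 < c₁)
    (he₁ : ∀ p q : Z, c₁ * max (dist (e p).1 (e q).1) (dist (e p).2 (e q).2) ≤ dist p q)
    (s t : ℝ≥0) :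
    ∃ A : ℝ, 0 < A ∧ ∀ (Φ : ℝ → ℝ) (δ : ℝ), 0 < Φ δ → 0 < δ → δ < ρ₀ → Φ δ ≤ c * δ / 2 →
      ∀ ε ε' : ℝ, 0 < ε → 0 < ε' → HasCover Φ (e ⁻¹' (E ×ˢ F)) (s + t) (A * ε * ε') δ →
        HasCover Φ E s ε δ ∨ HasCover Φ F t ε' δ := by
  classical
  set L : ℝ := max 1 (1 / c₁) with hL
  have hL1 : 1 ≤ L := le_max_left _ _
  have hL0 : 0 < L := by linarith
  obtain ⟨A, hA, hAE⟩ := hasCover_of_finset hc hX hE (K := 5 * L) (by linarith) s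
  obtain ⟨B, hB, hBF⟩ := hasCover_of_finset hc hY hF hL1 t
  -- The constant is the product of the losses in adjusting the covers of `E` and `F`. The factor 5
  -- comes from the Vitali enlargement: `L + 2 * (2 * L)`.
  refine ⟨1 / (A * (5 * L) ^ (s : ℝ) * (B * L ^ (t : ℝ))), by positivity,
    fun Φ δ hΦ hδ hδ' hφδ ε ε' hε hε' hcov => ?_⟩
  by_contra! hcon
  obtain ⟨hnE, hnF⟩ := hcon
  obtain ⟨𝒰, h𝒰, hdiam, hsum⟩ := hcov.exists_finset hΦ hδ.le (by positivity)
  have hd0 : ∀ W ∈ 𝒰, 0 < Metric.diam W := fun W hW => hΦ.trans_le (hdiam W hW).1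
  have hdist : ∀ W ∈ 𝒰, ∀ p ∈ W, ∀ q ∈ W,
      max (dist (e p).1 (e q).1) (dist (e p).2 (e q).2) ≤ L * Metric.diam W := by
    intro W hW p hp q hq
    have h1 := (he₁ p q).trans ((hdiam W hW).2.2 p hp q hq)
    calc _ ≤ 1 / c₁ * Metric.diam W := by
          rw [one_div_mul_eq_div, le_div_iff₀ hc₁]; linarith
      _ ≤ _ := mul_le_mul_of_nonneg_right (le_max_right _ _) (hd0 W hW).le
  set P : Set Z → Set X := fun W => {x | ∃ y, e.symm (x, y) ∈ W} with hP
  have hPdist : ∀ W ∈ 𝒰, ∀ x ∈ P W, ∀ x' ∈ P W, dist x x' ≤ L * Metric.diam W := by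
    rintro W hW x ⟨y, hy⟩ x' ⟨y', hy'⟩
    simpa using (le_max_left _ _).trans (hdist W hW _ hy _ hy')
  -- If the weights over `x` were too small, the fibres over `x` would be a cheap cover of `F`.
  have hweight : ∀ x ∈ E, ∀ S ⊆ 𝒰, (∀ W ∈ 𝒰, x ∈ P W → W ∈ S) →
      ε' / (B * L ^ (t : ℝ)) ≤ ∑ W ∈ S, Metric.diam W ^ (t : ℝ) := by
    intro x hx S hS hxS
    by_contra! hlt
    refine hnF ((hBF Φ δ hΦ hδ hδ' hφδ S (fun W => {y | e.symm (x, y) ∈ W})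
      (fun W => L * Metric.diam W) ?_ ?_).mono ?_)
    · intro W hW
      have hd := hdiam W (hS hW)
      have hd' := hd0 W (hS hW)
      refine ⟨by positivity, ?_, by nlinarith, fun y hy y' hy' => ?_⟩
      · have := mul_le_mul hL1 hL1 zero_le_one hL0.le
        nlinarith
      · simpa using (le_max_right _ _).trans (hdist W (hS hW) _ hy _ hy')
    · intro y hy
      have hz : e.symm (x, y) ∈ e ⁻¹' (E ×ˢ F) := by simpa using ⟨hx, hy⟩
      obtain ⟨W, hW, hWz⟩ := mem_iUnion₂.1 (h𝒰 hz)
      exact mem_iUnion₂.2 ⟨W, hxS W hW ⟨y, hWz⟩, hWz⟩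
    · rw [lt_div_iff₀ (by positivity)] at hlt
      calc B * ∑ W ∈ S, (L * Metric.diam W) ^ (t : ℝ)
          = (∑ W ∈ S, Metric.diam W ^ (t : ℝ)) * (B * L ^ (t : ℝ)) := by
            simp_rw [Real.mul_rpow hL0.le Metric.diam_nonneg]
            rw [← Finset.mul_sum]
            ring
        _ ≤ ε' := hlt.le
  obtain ⟨J, hJ, hJE, hJsum⟩ := exists_subcover_of_weighted (B := P) 𝒰
    (c := fun W => Metric.diam W ^ (s : ℝ)) (fun W _ => Real.rpow_nonneg Metric.diam_nonneg _)
    (fun S hS => exists_disjoint_enlargement P (fun W => L * Metric.diam W) S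
      (fun W _ => mul_nonneg hL0.le Metric.diam_nonneg) fun W hW => hPdist W (hS hW))
    (fun W => Metric.diam W ^ (t : ℝ)) (fun W _ => Real.rpow_nonneg Metric.diam_nonneg _)
    (a := ε' / (B * L ^ (t : ℝ))) (by positivity) hweight
  refine hnE ((hAE Φ δ hΦ hδ hδ' hφδ J _ (fun W => 5 * L * Metric.diam W) ?_ hJE).mono ?_)
  · intro W hW
    have hd := hdiam W (hJ hW)
    have hd' := hd0 W (hJ hW)
    refine ⟨by positivity, ?_, by nlinarith, ?_⟩
    · have : (1 : ℝ) ≤ 5 * L * (5 * L) := by nlinarith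
      nlinarith
    · rintro x ⟨x', hx', hxx'⟩ y ⟨y', hy', hyy'⟩
      have h1 := hPdist W (hJ hW) x' hx' y' hy'
      have h2 := dist_triangle4 x x' y' y
      rw [dist_comm y' y] at h2
      linarith
  · have h1 : ∑ W ∈ 𝒰, Metric.diam W ^ (t : ℝ) * Metric.diam W ^ (s : ℝ)
        = ∑ W ∈ 𝒰, Metric.diam W ^ ((s + t : ℝ≥0) : ℝ) := by
      refine Finset.sum_congr rfl fun W hW => ?_
      rw [NNReal.coe_add, Real.rpow_add (hd0 W hW), mul_comm]
    have h2 := hJsum.trans (h1.le.trans hsum)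
    have h3 : ∑ W ∈ J, (5 * L * Metric.diam W) ^ (s : ℝ)
        = (5 * L) ^ (s : ℝ) * ∑ W ∈ J, Metric.diam W ^ (s : ℝ) := by
      simp_rw [Real.mul_rpow (show 0 ≤ 5 * L by positivity) Metric.diam_nonneg]
      rw [← Finset.mul_sum]
    rw [h3]
    set Q := ∑ W ∈ J, Metric.diam W ^ (s : ℝ)
    rw [div_mul_eq_mul_div, div_le_iff₀ (by positivity)] at h2
    have h4 : 1 / (A * (5 * L) ^ (s : ℝ) * (B * L ^ (t : ℝ))) * ε * ε' * (B * L ^ (t : ℝ))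
        = ε' * (ε / (A * (5 * L) ^ (s : ℝ))) := by
      field_simp
    rw [h4] at h2
    have h5 := le_of_mul_le_mul_left h2 hε'
    rw [le_div_iff₀ (by positivity)] at h5
    linarith

theorem HasCover.prod {c ρ₀ : ℝ} (hc : 0 < c) (hZ : BallSpread Z c ρ₀)
    (hEF : Doubling (e ⁻¹' (E ×ˢ F)))
    (he₂ : ∀ p q : Z, dist p q ≤ c₂ * max (dist (e p).1 (e q).1) (dist (e p).2 (e q).2))
    (s t : ℝ≥0) :
    ∃ A : ℝ, 0 < A ∧ ∀ (Φ : ℝ → ℝ) (δ : ℝ), 0 < Φ δ → 0 < δ → δ < ρ₀ → Φ δ ≤ c * δ / 2 →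
      (∀ r, 0 < r → r ≤ δ → ∃ u : Finset Y, (u.card : ℝ) ≤ r ^ (-(t : ℝ)) ∧
        F ⊆ ⋃ y ∈ u, Metric.ball y (r / 2)) →
      ∀ ε : ℝ, 0 < ε → HasCover Φ E s ε δ → HasCover Φ (e ⁻¹' (E ×ˢ F)) (s + t) (A * ε) δ := by
  classical
  set L : ℝ := max 1 c₂ with hL
  have hL1 : 1 ≤ L := le_max_left _ _
  have hL0 : 0 < L := by linarith
  obtain ⟨A, hA, hAE⟩ := hasCover_of_finset hc hZ hEF hL1 (s + t)
  refine ⟨A * L ^ ((s + t : ℝ≥0) : ℝ), by positivity,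
    fun Φ δ hΦ hδ hδ' hφδ hbox ε hε hcov => ?_⟩
  obtain ⟨𝒰, h𝒰, hdiam, hsum⟩ := hcov.exists_finset hΦ hδ.le hε.le
  have hd0 : ∀ U ∈ 𝒰, 0 < Metric.diam U := fun U hU => hΦ.trans_le (hdiam U hU).1
  have hbox' : ∀ U ∈ 𝒰, _ := fun U hU => hbox (Metric.diam U) (hd0 U hU) (hdiam U hU).2.1
  choose! u hu using hbox'
  -- The pieces are `U × ball`, with balls of diameter at most `|U|`, so their diameters are at most
  -- `L * |U|`.
  refine (hAE Φ δ hΦ hδ hδ' hφδ (𝒰.sigma u)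
    (fun i => e ⁻¹' (i.1 ×ˢ Metric.ball i.2 (Metric.diam i.1 / 2)))
    (fun i => L * Metric.diam i.1) ?_ ?_).mono ?_
  · rintro ⟨U, y⟩ hi
    have hU := (Finset.mem_sigma.1 hi).1
    have hd := hdiam U hU
    have hd' := hd0 U hU
    dsimp only at hU hd hd' ⊢
    refine ⟨by positivity, ?_, by nlinarith, fun p hp q hq => ?_⟩
    · have := mul_le_mul hL1 hL1 zero_le_one hL0.le
      nlinarith
    · have h1 : dist (e p).1 (e q).1 ≤ Metric.diam U := hd.2.2 _ hp.1 _ hq.1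
      have h2 : dist (e p).2 (e q).2 ≤ Metric.diam U := by
        have := dist_triangle_right (e p).2 (e q).2 y
        have h3 := Metric.mem_ball.1 hp.2
        have h4 := Metric.mem_ball.1 hq.2
        linarith
      calc dist p q ≤ c₂ * max (dist (e p).1 (e q).1) (dist (e p).2 (e q).2) := he₂ p q
        _ ≤ L * Metric.diam U := by
          gcongr
          · exact le_max_right _ _
          · exact max_le h1 h2
  · rintro z ⟨hzE, hzF⟩
    obtain ⟨U, hU, hzU⟩ := mem_iUnion₂.1 (h𝒰 hzE)
    obtain ⟨y, hy, hzy⟩ := mem_iUnion₂.1 ((hu U hU).2 hzF)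
    exact mem_iUnion₂.2 ⟨⟨U, y⟩, Finset.mem_sigma.2 ⟨hU, hy⟩, hzU, hzy⟩
  · rw [Finset.sum_sigma, mul_assoc]
    gcongr
    calc ∑ U ∈ 𝒰, ∑ _y ∈ u U, (L * Metric.diam U) ^ ((s + t : ℝ≥0) : ℝ)
        ≤ ∑ U ∈ 𝒰, L ^ ((s + t : ℝ≥0) : ℝ) * Metric.diam U ^ (s : ℝ) := by
          refine Finset.sum_le_sum fun U hU => ?_
          have hd' := hd0 U hU
          rw [Finset.sum_const, nsmul_eq_mul, Real.mul_rpow hL0.le hd'.le]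
          calc ((u U).card : ℝ) * (L ^ ((s + t : ℝ≥0) : ℝ) * Metric.diam U ^ ((s + t : ℝ≥0) : ℝ))
              ≤ Metric.diam U ^ (-(t : ℝ)) *
                  (L ^ ((s + t : ℝ≥0) : ℝ) * Metric.diam U ^ ((s + t : ℝ≥0) : ℝ)) := by
                gcongr
                exact (hu U hU).1
            _ = L ^ ((s + t : ℝ≥0) : ℝ) *
                  (Metric.diam U ^ ((s + t : ℝ≥0) : ℝ) * Metric.diam U ^ (-(t : ℝ))) := by ring
            _ = _ := by rw [← Real.rpow_add hd', NNReal.coe_add, add_neg_cancel_right]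
      _ = L ^ ((s + t : ℝ≥0) : ℝ) * ∑ U ∈ 𝒰, Metric.diam U ^ (s : ℝ) := by rw [Finset.mul_sum]
      _ ≤ _ := by gcongr

end Product


/-! ### Small scales, box dimension and splitting of exponents -/

theorem Admissible.exists_forall_le {Φ : ℝ → ℝ} (h : Admissible Φ) {η : ℝ} (hη : 0 < η) :
    ∃ δ₁ : ℝ, 0 < δ₁ ∧ ∀ δ, 0 < δ → δ < δ₁ → 0 < Φ δ ∧ Φ δ ≤ η * δ := by
  obtain ⟨Δ, hΔ, -, hpos, hlim⟩ := h
  obtain ⟨u, hu, hu'⟩ := mem_nhdsGT_iff_exists_Ioo_subset.1 (hlim.eventually (Iio_mem_nhds hη))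
  refine ⟨min Δ u, lt_min hΔ hu, fun δ hδ hδ' => ?_⟩
  rw [lt_min_iff] at hδ'
  refine ⟨(hpos δ ⟨hδ, hδ'.1⟩).1, ?_⟩
  have h1 : Φ δ / δ < η := hu' ⟨hδ, hδ'.2⟩
  rw [div_lt_iff₀ hδ] at h1
  exact h1.le

theorem BallSpread.mono {X : Type*} [MetricSpace X] {c c' ρ₀ ρ₀' : ℝ} (h : BallSpread X c ρ₀)
    (hc : c' ≤ c) (hρ : ρ₀' ≤ ρ₀) : BallSpread X c' ρ₀' := by
  intro x ρ h0 h1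
  obtain ⟨y, hy, hy'⟩ := h x ρ h0 (h1.trans_le hρ)
  exact ⟨y, hy, le_trans (by gcongr) hy'⟩

theorem exists_finset_of_upperBoxDim_lt {Y : Type*} [MetricSpace Y] {F : Set Y} {t : ℝ≥0}
    (h : upperBoxDim F < t) :
    ∃ δ₁ : ℝ, 0 < δ₁ ∧ ∀ r, 0 < r → r < δ₁ → ∃ u : Finset Y, (u.card : ℝ) ≤ r ^ (-(t : ℝ)) ∧
      F ⊆ ⋃ y ∈ u, Metric.ball y (r / 2) := by
  obtain ⟨δ₁, hδ₁, hsub⟩ := mem_nhdsGT_iff_exists_Ioo_subset.1 (eventually_lt_of_limsup_lt h)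
  refine ⟨min δ₁ 1, lt_min hδ₁ one_pos, fun r hr hr' => ?_⟩
  rw [lt_min_iff] at hr'
  have h1 : (ENNReal.log (coverNum r F : ℝ≥0∞)).toENNReal / ENNReal.ofReal (-Real.log r) < t :=
    hsub ⟨hr, hr'.1⟩
  have hlog : 0 < -Real.log r := neg_pos.2 (Real.log_neg hr hr'.2)
  have h2 : (ENNReal.log (coverNum r F : ℝ≥0∞)).toENNReal
      ≤ ENNReal.ofReal (t * -Real.log r) := by
    have := (ENNReal.div_lt_iff (Or.inl (ENNReal.ofReal_pos.2 hlog).ne')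
      (Or.inl ENNReal.ofReal_ne_top)).1 h1
    rw [ENNReal.ofReal_mul t.coe_nonneg, ENNReal.ofReal_coe_nnreal]
    exact this.le
  -- `toENNReal` truncates negative logarithms to 0, which preserves the upper bound.
  have h3 : ENNReal.log (coverNum r F : ℝ≥0∞) ≤ ((t * -Real.log r : ℝ) : EReal) := by
    refine (EReal.coe_toENNReal_eq_max.ge.trans' (le_max_right _ _)).trans
      ((EReal.coe_ennreal_le_coe_ennreal_iff.2 h2).trans ?_)
    rw [EReal.coe_ennreal_ofReal, max_eq_left (by positivity)]
  have h4 : (coverNum r F : ℝ≥0∞) ≤ ENNReal.ofReal (r ^ (-(t : ℝ))) := by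
    have := EReal.exp_monotone h3
    rw [ENNReal.exp_log, EReal.exp_coe] at this
    rwa [Real.rpow_def_of_pos hr, show Real.log r * -(t : ℝ) = t * -Real.log r by ring]
  exact exists_finset_of_coverNum_le h4 (by positivity)

/-- The alternatives `s = 0` and `t = 0` are needed because `a` or `b` may vanish. -/
theorem exists_add_eq_of_lt_add {u : ℝ≥0} {a b : ℝ≥0∞} (h : (u : ℝ≥0∞) < a + b) :
    ∃ s t : ℝ≥0, s + t = u ∧ (s = 0 ∨ (s : ℝ≥0∞) < a) ∧ (t = 0 ∨ (t : ℝ≥0∞) < b) := by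
  rcases lt_or_ge (u : ℝ≥0∞) a with hua | hau
  · exact ⟨u, 0, add_zero u, Or.inr hua, Or.inl rfl⟩
  lift a to ℝ≥0 using ne_top_of_le_ne_top ENNReal.coe_ne_top hau
  have hau' : a ≤ u := by exact_mod_cast hau
  have hb : ((u - a : ℝ≥0) : ℝ≥0∞) < b := by
    rw [← tsub_add_cancel_of_le hau', add_comm, ENNReal.coe_add] at h
    exact lt_of_add_lt_add_left h
  obtain ⟨r, hr, hrb⟩ := ENNReal.lt_iff_exists_nnreal_btwn.1 hb
  have hr' : u - a < r := by exact_mod_cast hr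
  refine ⟨u - min r u, min r u, tsub_add_cancel_of_le (min_le_right _ _), ?_, Or.inr ?_⟩
  · rcases le_total r u with hru | hru
    · right
      rw [min_eq_left hru]
      have := (tsub_lt_iff_right hau').1 hr'
      exact_mod_cast (tsub_lt_iff_right hru).2 (by rwa [add_comm])
    · left
      rw [min_eq_right hru, tsub_self]
  · refine lt_of_le_of_lt ?_ hrb
    exact_mod_cast min_le_left r u

/-! ### Failure of covers below the dimensions -/

section Dimension

variable {X : Type*} [MetricSpace X] {Φ : ℝ → ℝ} {F : Set X}

theorem upperPhiDim_le {s : ℝ≥0}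
    (h : ∀ ε : ℝ, 0 < ε → ∃ δ₀ ∈ Ioc (0 : ℝ) 1, ∀ δ ∈ Ioo 0 δ₀, HasCover Φ F s ε δ) :
    upperPhiDim Φ F ≤ s :=
  iInf₂_le s h

theorem lowerPhiDim_le {s : ℝ≥0}
    (h : ∀ ε : ℝ, 0 < ε → ∀ δ₀ ∈ Ioc (0 : ℝ) 1, ∃ δ ∈ Ioo 0 δ₀, HasCover Φ F s ε δ) :
    lowerPhiDim Φ F ≤ s :=
  iInf₂_le s h

/-- Below the upper dimension good covers fail at arbitrarily small scales. -/
theorem exists_not_hasCover_of_lt_upperPhiDim (hΦ : Admissible Φ) (hF : F.Nonempty) {s : ℝ≥0}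
    (hs : s = 0 ∨ (s : ℝ≥0∞) < upperPhiDim Φ F) :
    ∃ ε : ℝ, 0 < ε ∧ ∀ δ₀ : ℝ, 0 < δ₀ → ∃ δ, 0 < δ ∧ δ < δ₀ ∧ ¬ HasCover Φ F s ε δ := by
  rcases hs with rfl | hs
  · obtain ⟨δ₁, hδ₁, h⟩ := hΦ.exists_forall_le one_pos
    refine ⟨1 / 2, by norm_num, fun δ₀ hδ₀ => ?_⟩
    obtain ⟨δ, hδ, hδ'⟩ := exists_between (lt_min hδ₀ hδ₁)
    rw [lt_min_iff] at hδ'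
    exact ⟨δ, hδ, hδ'.1, not_hasCover_zero hF (h δ hδ hδ'.2).1 hδ.le⟩
  · by_contra! hcon
    refine hs.not_ge (upperPhiDim_le fun ε hε => ?_)
    obtain ⟨δ₀, hδ₀, h⟩ := hcon ε hε
    exact ⟨min δ₀ 1, ⟨lt_min hδ₀ one_pos, min_le_right _ _⟩,
      fun δ hδ => h δ hδ.1 (hδ.2.trans_le (min_le_left _ _))⟩

/-- Below the lower dimension good covers fail at all small scales. -/
theorem exists_forall_not_hasCover_of_lt_lowerPhiDim (hΦ : Admissible Φ) (hF : F.Nonempty)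
    {s : ℝ≥0} (hs : s = 0 ∨ (s : ℝ≥0∞) < lowerPhiDim Φ F) :
    ∃ ε : ℝ, 0 < ε ∧ ∃ δ₀ : ℝ, 0 < δ₀ ∧ ∀ δ, 0 < δ → δ < δ₀ → ¬ HasCover Φ F s ε δ := by
  rcases hs with rfl | hs
  · obtain ⟨δ₁, hδ₁, h⟩ := hΦ.exists_forall_le one_pos
    exact ⟨1 / 2, by norm_num, δ₁, hδ₁,
      fun δ hδ hδ' => not_hasCover_zero hF (h δ hδ hδ').1 hδ.le⟩
  · by_contra! hcon
    refine hs.not_ge (lowerPhiDim_le fun ε hε δ₀ hδ₀ => ?_)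
    obtain ⟨δ, h1, h2, h3⟩ := hcon ε hε δ₀ hδ₀.1
    exact ⟨δ, ⟨h1, h2⟩, h3⟩

end Dimension

/-! ### Dimension inequalities for products -/

section Product

variable {X Y Z : Type*} [MetricSpace X] [MetricSpace Y] [MetricSpace Z] [Nontrivial X]
  {Φ : ℝ → ℝ} {E : Set X} {F : Set Y} {e : Z ≃ X × Y} {c₁ c₂ : ℝ}

theorem exists_lower_comparison [Nontrivial Y] (hX : UniformlyPerfect X) (hY : UniformlyPerfect Y)
    (hΦ : Admissible Φ) (hEA : assouadDim E < ⊤) (hFA : assouadDim F < ⊤) (hc₁ : 0 < c₁)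
    (he₁ : ∀ p q : Z, c₁ * max (dist (e p).1 (e q).1) (dist (e p).2 (e q).2) ≤ dist p q)
    (s t : ℝ≥0) :
    ∃ A δ₁ : ℝ, 0 < A ∧ 0 < δ₁ ∧ ∀ δ, 0 < δ → δ < δ₁ → ∀ ε ε' : ℝ, 0 < ε → 0 < ε' →
      HasCover Φ (e ⁻¹' (E ×ˢ F)) (s + t) (A * ε * ε') δ →
        HasCover Φ E s ε δ ∨ HasCover Φ F t ε' δ := by
  obtain ⟨c, ρ, hc, hρ, hXs⟩ := hX.exists_ballSpread
  obtain ⟨c', ρ', hc', hρ', hYs⟩ := hY.exists_ballSpread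
  obtain ⟨A, hA, h⟩ := hasCover_or_hasCover_of_prod (lt_min hc hc')
    (hXs.mono (min_le_left c c') (min_le_left ρ ρ'))
    (hYs.mono (min_le_right c c') (min_le_right ρ ρ'))
    (doubling_of_assouadDim_lt_top hEA) (doubling_of_assouadDim_lt_top hFA) hc₁ he₁ s t
  obtain ⟨δ₁, hδ₁, hΦ'⟩ := hΦ.exists_forall_le (half_pos (lt_min hc hc'))
  refine ⟨A, min δ₁ (min ρ ρ'), hA, lt_min hδ₁ (lt_min hρ hρ'), fun δ hδ hδ' => ?_⟩
  have hδ'' := lt_min_iff.1 hδ'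
  have hΦδ := hΦ' δ hδ hδ''.1
  exact h Φ δ hΦδ.1 hδ hδ''.2 (by linarith [hΦδ.2])

theorem exists_upper_comparison (hX : UniformlyPerfect X)
    (hΦ : Admissible Φ) (hEA : assouadDim E < ⊤) (hFA : assouadDim F < ⊤) (hc₁ : 0 < c₁)
    (hc₂ : 0 < c₂)
    (he₁ : ∀ p q : Z, c₁ * max (dist (e p).1 (e q).1) (dist (e p).2 (e q).2) ≤ dist p q)
    (he₂ : ∀ p q : Z, dist p q ≤ c₂ * max (dist (e p).1 (e q).1) (dist (e p).2 (e q).2))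
    (s : ℝ≥0) {t : ℝ≥0} (ht : upperBoxDim F < t) :
    ∃ A δ₁ : ℝ, 0 < A ∧ 0 < δ₁ ∧ ∀ δ, 0 < δ → δ < δ₁ → ∀ ε : ℝ, 0 < ε →
      HasCover Φ E s ε δ → HasCover Φ (e ⁻¹' (E ×ˢ F)) (s + t) (A * ε) δ := by
  obtain ⟨c, ρ, hc, hρ, hXs⟩ := hX.exists_ballSpread
  have hc' : 0 < c₁ * c / c₂ := by positivity
  obtain ⟨A, hA, h⟩ := HasCover.prod hc' (hXs.of_equiv_prod hc₁ hc₂ he₁ he₂)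
    ((doubling_of_assouadDim_lt_top hEA).preimage_prod (doubling_of_assouadDim_lt_top hFA)
      hc₁ hc₂ he₁ he₂) he₂ s t
  obtain ⟨δ₁, hδ₁, hΦ'⟩ := hΦ.exists_forall_le (half_pos hc')
  obtain ⟨δ₂, hδ₂, hbox⟩ := exists_finset_of_upperBoxDim_lt ht
  refine ⟨A, min (min δ₁ δ₂) (c₂ * ρ), hA, lt_min (lt_min hδ₁ hδ₂) (by positivity),
    fun δ hδ hδ' => ?_⟩
  rw [lt_min_iff, lt_min_iff] at hδ'
  have hΦδ := hΦ' δ hδ hδ'.1.1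
  exact h Φ δ hΦδ.1 hδ hδ'.2 (by linarith [hΦδ.2])
    fun r hr hr' => hbox r hr (hr'.trans_lt hδ'.1.2)

theorem upperPhiDim_add_lowerPhiDim_le [Nontrivial Y] (hX : UniformlyPerfect X) (hY : UniformlyPerfect Y)
    (hΦ : Admissible Φ) (hE : E.Nonempty) (hF : F.Nonempty)
    (hEA : assouadDim E < ⊤) (hFA : assouadDim F < ⊤) (hc₁ : 0 < c₁)
    (he₁ : ∀ p q : Z, c₁ * max (dist (e p).1 (e q).1) (dist (e p).2 (e q).2) ≤ dist p q) :
    upperPhiDim Φ E + lowerPhiDim Φ F ≤ upperPhiDim Φ (e ⁻¹' (E ×ˢ F)) := by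
  refine le_iInf₂ fun u hu => ?_
  by_contra! hlt
  obtain ⟨s, t, rfl, hs, ht⟩ := exists_add_eq_of_lt_add hlt
  obtain ⟨ε, hε, hEs⟩ := exists_not_hasCover_of_lt_upperPhiDim hΦ hE hs
  obtain ⟨ε', hε', δ₂, hδ₂, hFt⟩ := exists_forall_not_hasCover_of_lt_lowerPhiDim hΦ hF ht
  obtain ⟨A, δ₁, hA, hδ₁, hcomp⟩ := exists_lower_comparison hX hY hΦ hEA hFA hc₁ he₁ s t
  obtain ⟨δ₀, hδ₀, hcov⟩ := hu (A * ε * ε') (by positivity)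
  -- `E` fails at some scale below any bound, and `F` fails at every small scale, so this `δ`
  -- defeats both alternatives.
  obtain ⟨δ, hδ, hδ', hnot⟩ := hEs (min δ₀ (min δ₁ δ₂)) (lt_min hδ₀.1 (lt_min hδ₁ hδ₂))
  rw [lt_min_iff, lt_min_iff] at hδ'
  rcases hcomp δ hδ hδ'.2.1 ε ε' hε hε' (hcov δ ⟨hδ, hδ'.1⟩) with h | h
  · exact hnot h
  · exact hFt δ hδ hδ'.2.2 h

theorem lowerPhiDim_add_lowerPhiDim_le [Nontrivial Y] (hX : UniformlyPerfect X) (hY : UniformlyPerfect Y)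
    (hΦ : Admissible Φ) (hE : E.Nonempty) (hF : F.Nonempty)
    (hEA : assouadDim E < ⊤) (hFA : assouadDim F < ⊤) (hc₁ : 0 < c₁)
    (he₁ : ∀ p q : Z, c₁ * max (dist (e p).1 (e q).1) (dist (e p).2 (e q).2) ≤ dist p q) :
    lowerPhiDim Φ E + lowerPhiDim Φ F ≤ lowerPhiDim Φ (e ⁻¹' (E ×ˢ F)) := by
  refine le_iInf₂ fun u hu => ?_
  by_contra! hlt
  obtain ⟨s, t, rfl, hs, ht⟩ := exists_add_eq_of_lt_add hlt
  obtain ⟨ε, hε, δ₃, hδ₃, hEs⟩ := exists_forall_not_hasCover_of_lt_lowerPhiDim hΦ hE hs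
  obtain ⟨ε', hε', δ₂, hδ₂, hFt⟩ := exists_forall_not_hasCover_of_lt_lowerPhiDim hΦ hF ht
  obtain ⟨A, δ₁, hA, hδ₁, hcomp⟩ := exists_lower_comparison hX hY hΦ hEA hFA hc₁ he₁ s t
  obtain ⟨δ, ⟨hδ, hδ'⟩, hcov⟩ := hu (A * ε * ε') (by positivity)
    (min 1 (min δ₃ (min δ₁ δ₂))) ⟨by positivity, min_le_left _ _⟩
  simp only [lt_min_iff] at hδ'
  rcases hcomp δ hδ hδ'.2.2.1 ε ε' hε hε' hcov with h | h
  · exact hEs δ hδ hδ'.2.1 h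
  · exact hFt δ hδ hδ'.2.2.2 h

/-- With exponents `u / 2` in both factors, the two alternatives of the comparison are the same
statement about `F`, so failure at arbitrarily small scales is enough. -/
theorem two_mul_upperPhiDim_le {e : Z ≃ Y × Y} [Nontrivial Y] (hY : UniformlyPerfect Y)
    (hΦ : Admissible Φ) (hF : F.Nonempty) (hFA : assouadDim F < ⊤) (hc₁ : 0 < c₁)
    (he₁ : ∀ p q : Z, c₁ * max (dist (e p).1 (e q).1) (dist (e p).2 (e q).2) ≤ dist p q) :
    2 * upperPhiDim Φ F ≤ upperPhiDim Φ (e ⁻¹' (F ×ˢ F)) := by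
  refine le_iInf₂ fun u hu => ?_
  by_contra! hlt
  have hs : ((u / 2 : ℝ≥0) : ℝ≥0∞) < upperPhiDim Φ F := by
    rw [ENNReal.coe_div two_ne_zero, ENNReal.coe_ofNat]
    exact ENNReal.div_lt_of_lt_mul' hlt
  obtain ⟨ε, hε, hFs⟩ := exists_not_hasCover_of_lt_upperPhiDim hΦ hF (Or.inr hs)
  obtain ⟨A, δ₁, hA, hδ₁, hcomp⟩ :=
    exists_lower_comparison hY hY hΦ hFA hFA hc₁ he₁ (u / 2) (u / 2)
  rw [add_halves] at hcomp
  obtain ⟨δ₀, hδ₀, hcov⟩ := hu (A * ε * ε) (by positivity)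
  obtain ⟨δ, hδ, hδ', hnot⟩ := hFs (min δ₀ δ₁) (lt_min hδ₀.1 hδ₁)
  rw [lt_min_iff] at hδ'
  exact hnot (or_self_iff.1 (hcomp δ hδ hδ'.2 ε ε hε hε (hcov δ ⟨hδ, hδ'.1⟩)))

theorem upperPhiDim_prod_le (hX : UniformlyPerfect X)
    (hΦ : Admissible Φ) (hEA : assouadDim E < ⊤) (hFA : assouadDim F < ⊤) (hc₁ : 0 < c₁)
    (hc₂ : 0 < c₂)
    (he₁ : ∀ p q : Z, c₁ * max (dist (e p).1 (e q).1) (dist (e p).2 (e q).2) ≤ dist p q)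
    (he₂ : ∀ p q : Z, dist p q ≤ c₂ * max (dist (e p).1 (e q).1) (dist (e p).2 (e q).2)) :
    upperPhiDim Φ (e ⁻¹' (E ×ˢ F)) ≤ upperPhiDim Φ E + upperBoxDim F := by
  -- Truncated subtraction isolates each dimension in turn: first to choose `t` above the box
  -- dimension, then to pass to the infimum over `s`.
  rw [← tsub_le_iff_left]
  by_contra! hlt
  obtain ⟨t, ht, ht'⟩ := ENNReal.lt_iff_exists_nnreal_btwn.1 hlt
  refine ht'.not_ge ?_
  rw [tsub_le_iff_left, ← tsub_le_iff_right]
  refine le_iInf₂ fun s hs => ?_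
  rw [tsub_le_iff_right, ← ENNReal.coe_add]
  obtain ⟨A, δ₁, hA, hδ₁, hcomp⟩ := exists_upper_comparison hX hΦ hEA hFA hc₁ hc₂ he₁ he₂ s ht
  refine upperPhiDim_le fun ε hε => ?_
  obtain ⟨δ₀, hδ₀, hcov⟩ := hs (ε / A) (by positivity)
  refine ⟨min δ₀ δ₁, ⟨lt_min hδ₀.1 hδ₁, (min_le_left _ _).trans hδ₀.2⟩, fun δ ⟨hδ, hδ'⟩ => ?_⟩
  rw [lt_min_iff] at hδ'
  have := hcomp δ hδ hδ'.2 (ε / A) (by positivity) (hcov δ ⟨hδ, hδ'.1⟩)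
  rwa [mul_div_cancel₀ _ hA.ne'] at this

theorem lowerPhiDim_prod_le (hX : UniformlyPerfect X)
    (hΦ : Admissible Φ) (hEA : assouadDim E < ⊤) (hFA : assouadDim F < ⊤) (hc₁ : 0 < c₁)
    (hc₂ : 0 < c₂)
    (he₁ : ∀ p q : Z, c₁ * max (dist (e p).1 (e q).1) (dist (e p).2 (e q).2) ≤ dist p q)
    (he₂ : ∀ p q : Z, dist p q ≤ c₂ * max (dist (e p).1 (e q).1) (dist (e p).2 (e q).2)) :
    lowerPhiDim Φ (e ⁻¹' (E ×ˢ F)) ≤ lowerPhiDim Φ E + upperBoxDim F := by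
  rw [← tsub_le_iff_left]
  by_contra! hlt
  obtain ⟨t, ht, ht'⟩ := ENNReal.lt_iff_exists_nnreal_btwn.1 hlt
  refine ht'.not_ge ?_
  rw [tsub_le_iff_left, ← tsub_le_iff_right]
  refine le_iInf₂ fun s hs => ?_
  rw [tsub_le_iff_right, ← ENNReal.coe_add]
  obtain ⟨A, δ₁, hA, hδ₁, hcomp⟩ := exists_upper_comparison hX hΦ hEA hFA hc₁ hc₂ he₁ he₂ s ht
  refine lowerPhiDim_le fun ε hε δ₀ hδ₀ => ?_
  obtain ⟨δ, ⟨hδ, hδ'⟩, hcov⟩ := hs (ε / A) (by positivity) (min δ₀ δ₁)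
    ⟨lt_min hδ₀.1 hδ₁, (min_le_left _ _).trans hδ₀.2⟩
  rw [lt_min_iff] at hδ'
  have := hcomp δ hδ hδ'.2 (ε / A) (by positivity) hcov
  rw [mul_div_cancel₀ _ hA.ne'] at this
  exact ⟨δ, ⟨hδ, hδ'.1⟩, this⟩

end Product

end PhiDim

theorem mainTheorem10 {X Y : Type*} [dX : MetricSpace X] [dY : MetricSpace Y]
    [Nontrivial X] [Nontrivial Y]
    (hX : PhiDim.UniformlyPerfect X) (hY : PhiDim.UniformlyPerfect Y)
    (Φ : ℝ → ℝ) (hΦ : PhiDim.Admissible Φ)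
    (E : Set X) (F : Set Y)
    (hE : E.Nonempty) (hF : F.Nonempty)
    (hEtb : TotallyBounded E) (hFtb : TotallyBounded F)
    (hEA : PhiDim.assouadDim E < ⊤) (hFA : PhiDim.assouadDim F < ⊤) :
    (∀ dXY : MetricSpace (X × Y), PhiDim.ComparableToMax dXY →
      (PhiDim.upperPhiDim Φ E + PhiDim.lowerPhiDim Φ F
          ≤ @PhiDim.upperPhiDim (X × Y) dXY Φ (E ×ˢ F) ∧
        @PhiDim.upperPhiDim (X × Y) dXY Φ (E ×ˢ F)
          ≤ PhiDim.upperPhiDim Φ E + PhiDim.upperBoxDim F) ∧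
      (PhiDim.lowerPhiDim Φ E + PhiDim.lowerPhiDim Φ F
          ≤ @PhiDim.lowerPhiDim (X × Y) dXY Φ (E ×ˢ F) ∧
        @PhiDim.lowerPhiDim (X × Y) dXY Φ (E ×ˢ F)
          ≤ PhiDim.lowerPhiDim Φ E + PhiDim.upperBoxDim F)) ∧
    (∀ dYY : MetricSpace (Y × Y), PhiDim.ComparableToMax dYY →
      2 * PhiDim.upperPhiDim Φ F ≤ @PhiDim.upperPhiDim (Y × Y) dYY Φ (F ×ˢ F) ∧
      @PhiDim.upperPhiDim (Y × Y) dYY Φ (F ×ˢ F)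
        ≤ PhiDim.upperPhiDim Φ F + PhiDim.upperBoxDim F) := by
  refine ⟨?_, ?_⟩
  · rintro dXY ⟨c₁, c₂, hc₁, hc₂, hcomp⟩
    have he₁ := fun p q => (hcomp p q).1
    have he₂ := fun p q => (hcomp p q).2
    exact ⟨⟨PhiDim.upperPhiDim_add_lowerPhiDim_le (e := Equiv.refl (X × Y)) hX hY hΦ hE hF hEA hFA
          hc₁ he₁,
        PhiDim.upperPhiDim_prod_le (e := Equiv.refl (X × Y)) hX hΦ hEA hFA hc₁ hc₂ he₁ he₂⟩,
      PhiDim.lowerPhiDim_add_lowerPhiDim_le (e := Equiv.refl (X × Y)) hX hY hΦ hE hF hEA hFA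
          hc₁ he₁,
      PhiDim.lowerPhiDim_prod_le (e := Equiv.refl (X × Y)) hX hΦ hEA hFA hc₁ hc₂ he₁ he₂⟩
  · rintro dYY ⟨c₁, c₂, hc₁, hc₂, hcomp⟩
    have he₁ := fun p q => (hcomp p q).1
    have he₂ := fun p q => (hcomp p q).2
    exact ⟨PhiDim.two_mul_upperPhiDim_le (e := Equiv.refl (Y × Y)) hY hΦ hF hFA hc₁ he₁,
      PhiDim.upperPhiDim_prod_le (e := Equiv.refl (Y × Y)) hY hΦ hFA hFA hc₁ hc₂ he₁ he₂⟩
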